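/- Let $I\ge 1$ and $\psi\ge 1$ be integers and let $\Omega>0$, $\sigma^2>0$ with $\sigma^2\neq 1$. Let $X_1,\dots,X_I$ be independent shadowed-Rician random variables with these parameters, i.e. each $X_i$ has the law of $(P_i+Z_ip_i)^2+(Q_i+Z_iq_i)^2$, where $P_i,Q_i\sim\mathcal N(0,\sigma^2/2)$, $p_i,q_i\in\mathbb R$ satisfy $p_i^2+q_i^2=1$, $Z_i$ is Nakagami with shape $\psi$ and spread $\mathbb E[Z_i^2]=\Omega$ (density $\frac{2\psi^\psi}{\Gamma(\psi)\Omega^\psi}z^{2\psi-1}e^{-\psi z^2/\Omega}$, $z>0$), and $P_i,Q_i,Z_i$ are independent. Put $$\kappa=\frac{1-\sigma^2}{\sigma^2},\quad \omega=\frac{\Omega(\kappa+1)}{\kappa},\quad \xi=\frac{\kappa\omega}{\psi},\quad \alpha=\frac{\xi+1}{\kappa+1},\quad \chi_{I,k}=\binom{I\psi-I}{k}\frac{1}{(\xi+1)^k}\Big(\frac{\xi}{\xi+1}\Big)^{I\psi-I-k}.$$ Then $Y=\sum_{i=1}^I X_i$ has a PDF that vanishes for $x\le 0$ and is given for $x>0$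 by $$f_Y(x)=\sum_{k=0}^{I\psi-I}\frac{\chi_{I,k}}{(I\psi-k-1)!}\,\frac{x^{I\psi-k-1}}{\alpha^{I\psi-k}}\,e^{-x/\alpha},$$ and its CDF is given for $x>0$ by $$F_Y(x)=\sum_{k=0}^{I\psi-I}\chi_{I,k}\frac{\gamma(I\psi-k,x/\alpha)}{(I\psi-k-1)!}=1-\sum_{k=0}^{I\psi-I}\sum_{n=0}^{I\psi-k-1}\frac{\chi_{I,k}}{n!}\,\frac{x^n}{\alpha^n}\,e^{-x/\alpha},$$ where $\gamma(a,x)=\int_0^x t^{a-1}e^{-t}\,dt$ is the lower incomplete Gamma function. Moreover $Y$ has finite first and second moments and, if $\psi\ge 2$, then for all real $\mu_1,\mu_2$ one has $\mathbb E[Y]=\mu_1$ and $\mathbb E[Y^2]=\mu_2$ if and only if $$\Omega=\frac{\sqrt{\psi}}{\sqrt{\psi-1}}\,\frac{\sqrt{\mu_1^2(I+1)-I\mu_2}}{I}\quad\text{with } \mu_1^2(I+1)-I\mu_2\ge 0,\qquad \sigma^2=\frac{\mu_1-I\Omega}{I}.$$ -/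

import Mathlib

open MeasureTheory ProbabilityTheory

noncomputable section

namespace SISR

/-- Density of the Nakagami distribution with shape `m` and spread `Ω` (the mean square). -/
def nakagamiPDFReal (m Ω x : ℝ) : ℝ :=
  if 0 < x then
    2 * m ^ m / (Real.Gamma m * Ω ^ m) * x ^ (2 * m - 1) * Real.exp (-(m / Ω) * x ^ 2)
  else 0

/-- The Nakagami distribution with shape `m` and spread `Ω`. -/
def nakagamiMeasure (m Ω : ℝ) : Measure ℝ :=
  volume.withDensity fun x => ENNReal.ofReal (nakagamiPDFReal m Ω x)

/-- The shadowed-Rician (power) distribution: the law of `(P + Z p)² + (Q + Z q)²`, where `P`, `Q`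
are centred Gaussian of variance `σ2 / 2`, `Z` is Nakagami with shape `m` and spread `Ω`, and
`P`, `Q`, `Z` are independent. The direction `(p, q)` is meant to be a unit vector. -/
def shadowedRicianMeasure (m Ω σ2 p q : ℝ) : Measure ℝ :=
  (((gaussianReal 0 (σ2 / 2).toNNReal).prod (gaussianReal 0 (σ2 / 2).toNNReal)).prod
    (nakagamiMeasure m Ω)).map
      fun v : (ℝ × ℝ) × ℝ => (v.1.1 + v.2 * p) ^ 2 + (v.1.2 + v.2 * q) ^ 2

/-- The lower incomplete Gamma function `γ(a, x)`, for `0 < a` and `0 ≤ x`. -/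
def lowerGamma (a x : ℝ) : ℝ :=
  ∫ t in (0 : ℝ)..x, t ^ (a - 1) * Real.exp (-t)

/-- `κ = (1 - σ²) / σ²`. -/
def kappa (σ2 : ℝ) : ℝ := (1 - σ2) / σ2

/-- `ω = Ω (κ + 1) / κ`. -/
def omega (Ω σ2 : ℝ) : ℝ := Ω * (kappa σ2 + 1) / kappa σ2

/-- `ξ = κ ω / ψ`. -/
def xi (ψ : ℕ) (Ω σ2 : ℝ) : ℝ := kappa σ2 * omega Ω σ2 / ψ

/-- `α = (ξ + 1) / (κ + 1)`. -/
def alpha (ψ : ℕ) (Ω σ2 : ℝ) : ℝ := (xi ψ Ω σ2 + 1) / (kappa σ2 + 1)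

/-- The weights `χ_{I,k}`, for `k ≤ I ψ - I`. -/
def chi (I ψ : ℕ) (Ω σ2 : ℝ) (k : ℕ) : ℝ :=
  ((I * ψ - I).choose k : ℝ) * (1 / (xi ψ Ω σ2 + 1) ^ k) *
    (xi ψ Ω σ2 / (xi ψ Ω σ2 + 1)) ^ (I * ψ - I - k)

/-- The density `f_Y(I, ψ; x)`, extended by `0` to `x ≤ 0`. -/
def sisrPDFReal (I ψ : ℕ) (Ω σ2 x : ℝ) : ℝ :=
  if 0 < x then
    ∑ k ∈ Finset.range (I * ψ - I + 1),
      chi I ψ Ω σ2 k / (I * ψ - k - 1).factorial *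
        (x ^ (I * ψ - k - 1) / alpha ψ Ω σ2 ^ (I * ψ - k)) * Real.exp (-x / alpha ψ Ω σ2)
  else 0

/-- The value of `Ω` matched to the moments `μ₁`, `μ₂`. -/
def matchedOmega (I ψ : ℕ) (μ₁ μ₂ : ℝ) : ℝ :=
  √(ψ : ℝ) / √((ψ : ℝ) - 1) * (√(μ₁ ^ 2 * ((I : ℝ) + 1) - I * μ₂) / I)

/-- The value of `σ²` matched to the moments `μ₁`, `μ₂`. -/
def matchedSigmaSq (I ψ : ℕ) (μ₁ μ₂ : ℝ) : ℝ :=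
  (μ₁ - I * matchedOmega I ψ μ₁ μ₂) / I

end SISR

end

namespace SISR

open Set Filter Topology

/-! Everything runs through characteristic functions. Conditionally on `Z`, the two Gaussian squares
give `exp(w Z²) / D` with `D = 1 - iσ²t` and `w = it / D`; since `Z²` is Gamma distributed, `X` has
characteristic function `D^(ψ-1) / E^ψ`, where `E = 1 - iαt` and `α = σ² + Ω/ψ`
(`charFun_shadowedRicianMeasure`). Independence turns this into `D^(Iψ-I) / E^(Iψ)` for `Y`.

As `α = σ²(ξ+1)`, `D` is the convex combination `E/(ξ+1) + ξ/(ξ+1)`. The binomial theorem then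
writes the quotient as `∑ χ_k E^(-(Iψ-k))`, a mixture of Gamma laws of shape `Iψ-k` and scale `α`
with binomial weights (`charFun_withDensity_sisrPDFReal`). Uniqueness of characteristic functions
gives the density, and integrating the mixture termwise gives the CDF and the moments.

For the matching, `I E[Y²] = (I+1) E[Y]² - (IΩ)²(ψ-1)/ψ`, so the two moments determine `Ω > 0` when
`ψ ≥ 2`, and the mean `I(σ²+Ω)` then gives `σ²`. -/

/-! ### Gamma integrals with real and complex rate -/

lemma integrableOn_pow_mul_exp_neg_mul (n : ℕ) {r : ℝ} (hr : 0 < r) :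
    IntegrableOn (fun t : ℝ => t ^ n * Real.exp (-(r * t))) (Ioi 0) := by
  have h := integrableOn_rpow_mul_exp_neg_mul_rpow (p := 1) (s := n) (b := r)
    (by have : (0 : ℝ) ≤ n := n.cast_nonneg
        linarith) one_pos hr
  simpa using h

lemma integral_pow_mul_exp_neg_mul (n : ℕ) {r : ℝ} (hr : 0 < r) :
    ∫ t in Ioi (0 : ℝ), t ^ n * Real.exp (-(r * t)) = n.factorial / r ^ (n + 1) := by
  have h := Real.integral_rpow_mul_exp_neg_mul_Ioi (a := (n : ℝ) + 1) (by positivity) hr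
  rw [Real.Gamma_nat_eq_factorial] at h
  simp only [add_sub_cancel_right, Real.rpow_natCast] at h
  rw [h]
  norm_cast
  rw [one_div, inv_pow]
  field_simp

lemma norm_pow_mul_cexp_neg_mul (n : ℕ) (r : ℂ) {t : ℝ} (ht : 0 ≤ t) :
    ‖(t : ℂ) ^ n * Complex.exp (-(r * t))‖ = t ^ n * Real.exp (-(r.re * t)) := by
  simp [Complex.norm_exp, abs_of_nonneg ht]

lemma integrableOn_pow_mul_cexp_neg_mul (n : ℕ) {r : ℂ} (hr : 0 < r.re) :
    IntegrableOn (fun t : ℝ => (t : ℂ) ^ n * Complex.exp (-(r * t))) (Ioi 0) := by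
  refine (integrableOn_pow_mul_exp_neg_mul n hr).mono' (by fun_prop) ?_
  filter_upwards [ae_restrict_mem measurableSet_Ioi] with t ht
  exact (norm_pow_mul_cexp_neg_mul n r (le_of_lt ht)).le

lemma tendsto_pow_mul_cexp_neg_mul (n : ℕ) {r : ℂ} (hr : 0 < r.re) :
    Tendsto (fun t : ℝ => (t : ℂ) ^ n * Complex.exp (-(r * t))) atTop (𝓝 0) := by
  rw [tendsto_zero_iff_norm_tendsto_zero]
  refine ((isLittleO_pow_exp_pos_mul_atTop n hr).tendsto_div_nhds_zero).congr' ?_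
  filter_upwards [eventually_ge_atTop (0 : ℝ)] with t ht
  rw [norm_pow_mul_cexp_neg_mul n r ht, Real.exp_neg, div_eq_mul_inv]

/-- The Gamma integral with integer shape and complex rate. -/
lemma integral_pow_mul_cexp_neg_mul (n : ℕ) {r : ℂ} (hr : 0 < r.re) :
    ∫ t in Ioi (0 : ℝ), (t : ℂ) ^ n * Complex.exp (-(r * t)) = n.factorial / r ^ (n + 1) := by
  have hr0 : r ≠ 0 := by
    rintro rfl
    simp at hr
  induction n with
  | zero =>
    have h := integral_exp_mul_complex_Ioi (a := -r) (by simpa using hr) 0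
    simpa using h
  | succ n ih =>
    -- Integrating this derivative over `(0, ∞)`, where both boundary terms vanish, gives the
    -- recursion `r J_(n+1) = (n+1) J_n`.
    have hd : ∀ t : ℝ, HasDerivAt (fun t : ℝ => (t : ℂ) ^ (n + 1) * Complex.exp (-(r * t)))
        (((n + 1 : ℕ) : ℂ) * ((t : ℂ) ^ n * Complex.exp (-(r * t))) -
          r * ((t : ℂ) ^ (n + 1) * Complex.exp (-(r * t)))) t := by
      intro t
      have h1 : HasDerivAt (fun t : ℝ => (t : ℂ)) 1 t := Complex.ofRealCLM.hasDerivAt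
      have h2 := (h1.pow (n + 1)).mul ((h1.const_mul r).neg.cexp)
      refine h2.congr_deriv ?_
      push_cast
      simp
      ring
    have hi1 := (integrableOn_pow_mul_cexp_neg_mul n hr).const_mul ((n + 1 : ℕ) : ℂ)
    have hi2 := (integrableOn_pow_mul_cexp_neg_mul (n + 1) hr).const_mul r
    have h := integral_Ioi_of_hasDerivAt_of_tendsto (a := 0)
      (hd 0).continuousAt.continuousWithinAt (fun t _ => hd t) (hi1.sub hi2)
      (tendsto_pow_mul_cexp_neg_mul (n + 1) hr)
    rw [integral_sub hi1 hi2, integral_const_mul, integral_const_mul, ih] at h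
    simp only [Complex.ofReal_zero, ne_eq, Nat.add_eq_zero_iff, one_ne_zero, and_false,
      not_false_eq_true, zero_pow, zero_mul, sub_zero] at h
    have h' := (sub_eq_zero.mp h).symm
    rw [← mul_right_inj' hr0, h', Nat.factorial_succ]
    push_cast
    field_simp
    ring

/-! ### Squares of shifted Gaussians -/

/-- The characteristic function of a squared shifted Gaussian; only the square of the
normalising factor is recorded, which does not depend on the shift. -/
lemma exists_integral_cexp_sq_gaussianReal {v : NNReal} (hv : v ≠ 0) (t : ℝ) :
    ∃ A : ℂ, A ^ 2 = 1 / (1 - 2 * v * t * Complex.I) ∧ ∀ c : ℝ,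
      ∫ x, Complex.exp (t * (x + c) ^ 2 * Complex.I) ∂(gaussianReal 0 v) =
        A * Complex.exp (t * Complex.I * c ^ 2 / (1 - 2 * v * t * Complex.I)) := by
  have hv0 : (0 : ℝ) < v := by positivity
  have hvC : (v : ℂ) ≠ 0 := by
    have := hv0.ne'
    exact_mod_cast this
  have hden : (1 - 2 * v * t * Complex.I : ℂ) ≠ 0 := by
    intro h
    have := congrArg Complex.re h
    simp at this
  set b : ℂ := t * Complex.I - 1 / (2 * v) with hb
  have hbre : b.re < 0 := by
    have : b.re = -(1 / (2 * v : ℝ)) := by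
      have h2 : (1 / (2 * v) : ℂ) = ((1 / (2 * v : ℝ) : ℝ) : ℂ) := by push_cast; rfl
      rw [hb, h2, Complex.sub_re, Complex.ofReal_re]
      simp
    rw [this, neg_lt_zero]
    positivity
  have hbeq : b = -(1 - 2 * v * t * Complex.I) / (2 * v) := by
    rw [hb]
    field_simp
    ring
  -- The branch of the square root is immaterial: the two Gaussian coordinates later contribute `A *
  -- A`.
  refine ⟨((√(2 * Real.pi * v))⁻¹ : ℝ) * (Real.pi / -b) ^ (1 / 2 : ℂ), ?_, ?_⟩
  · rw [mul_pow, ← Complex.cpow_nat_mul]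
    have h1 : ((2 : ℕ) : ℂ) * (1 / 2) = 1 := by norm_num
    rw [h1, Complex.cpow_one, ← Complex.ofReal_pow, inv_pow, Real.sq_sqrt (by positivity), hbeq]
    have := Real.pi_ne_zero
    have hpi : (Real.pi : ℂ) ≠ 0 := by exact_mod_cast this
    push_cast
    field_simp
  · intro c
    rw [integral_gaussianReal_eq_integral_smul hv]
    have hcongr : ∀ x : ℝ, gaussianPDFReal 0 v x • Complex.exp (t * (x + c) ^ 2 * Complex.I) =
        ((√(2 * Real.pi * v))⁻¹ : ℝ) *
          Complex.exp (b * x ^ 2 + 2 * c * t * Complex.I * x + t * c ^ 2 * Complex.I) := by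
      intro x
      rw [gaussianPDFReal, Complex.real_smul, Complex.ofReal_mul, mul_assoc, Complex.ofReal_exp,
        ← Complex.exp_add, hb]
      congr 2
      push_cast
      field_simp
      ring
    simp_rw [hcongr]
    rw [integral_const_mul, integral_cexp_quadratic hbre, ← mul_assoc]
    congr 2
    rw [hbeq]
    set D : ℂ := 1 - 2 * v * t * Complex.I with hD
    field_simp
    rw [hD]
    ring

/-! ### The Nakagami law -/

lemma measurable_nakagamiPDFReal (m Ω : ℝ) : Measurable (nakagamiPDFReal m Ω) := by
  unfold nakagamiPDFReal
  exact Measurable.ite measurableSet_Ioi (by fun_prop) measurable_const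

lemma nakagamiPDFReal_nonneg {m Ω : ℝ} (hm : 0 < m) (hΩ : 0 < Ω) (x : ℝ) :
    0 ≤ nakagamiPDFReal m Ω x := by
  unfold nakagamiPDFReal
  split_ifs with hx
  · have := Real.Gamma_pos_of_pos hm
    positivity
  · exact le_rfl

lemma nakagamiPDFReal_eq_indicator (m Ω : ℝ) :
    nakagamiPDFReal m Ω = (Ioi (0 : ℝ)).indicator fun x =>
      2 * m ^ m / (Real.Gamma m * Ω ^ m) * x ^ (2 * m - 1) * Real.exp (-(m / Ω) * x ^ 2) := by
  ext x
  simp only [nakagamiPDFReal, indicator, mem_Ioi]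

lemma isFiniteMeasure_nakagamiMeasure {m Ω : ℝ} (hm : 0 < m) (hΩ : 0 < Ω) :
    IsFiniteMeasure (nakagamiMeasure m Ω) := by
  refine isFiniteMeasure_withDensity_ofReal (Integrable.hasFiniteIntegral ?_)
  rw [nakagamiPDFReal_eq_indicator, integrable_indicator_iff measurableSet_Ioi]
  have h := (integrableOn_rpow_mul_exp_neg_mul_sq (div_pos hm hΩ)
    (s := 2 * m - 1) (by linarith)).const_mul (2 * m ^ m / (Real.Gamma m * Ω ^ m))
  simp_rw [← mul_assoc] at h
  exact h

lemma integral_nakagamiMeasure {m Ω : ℝ} (hm : 0 < m) (hΩ : 0 < Ω) (f : ℝ → ℂ) :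
    ∫ x, f x ∂(nakagamiMeasure m Ω) = ∫ x in Ioi (0 : ℝ), nakagamiPDFReal m Ω x • f x := by
  rw [nakagamiMeasure, integral_withDensity_eq_integral_toReal_smul
    (measurable_nakagamiPDFReal m Ω).ennreal_ofReal (ae_of_all _ fun _ => ENNReal.ofReal_lt_top),
    ← integral_indicator measurableSet_Ioi]
  congr 1 with x
  rw [ENNReal.toReal_ofReal (nakagamiPDFReal_nonneg hm hΩ x)]
  by_cases hx : 0 < x <;> simp [indicator, nakagamiPDFReal, hx]

/-- The Laplace transform of the square of a Nakagami variable with integer shape. -/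
lemma integral_cexp_mul_sq_nakagamiMeasure (n : ℕ) {Ω : ℝ} (hΩ : 0 < Ω) {w : ℂ} (hw : w.re ≤ 0) :
    ∫ x, Complex.exp (w * x ^ 2) ∂(nakagamiMeasure ((n + 1 : ℕ) : ℝ) Ω) =
      1 / (1 - w * (Ω / (n + 1 : ℕ))) ^ (n + 1) := by
  have hm : (0 : ℝ) < (n + 1 : ℕ) := by positivity
  have hmC : ((n + 1 : ℕ) : ℂ) ≠ 0 := by exact_mod_cast Nat.succ_ne_zero n
  have hΩC : (Ω : ℂ) ≠ 0 := by exact_mod_cast hΩ.ne'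
  set r : ℂ := ((n + 1 : ℕ) : ℂ) / Ω - w with hrdef
  have hr : 0 < r.re := by
    have h1 : r.re = ((n + 1 : ℕ) : ℝ) / Ω - w.re := by
      have : ((n + 1 : ℕ) : ℂ) / Ω = ((((n + 1 : ℕ) : ℝ) / Ω : ℝ) : ℂ) := by push_cast; rfl
      rw [hrdef, this, Complex.sub_re, Complex.ofReal_re]
    have : 0 < ((n + 1 : ℕ) : ℝ) / Ω := by positivity
    linarith
  have hr0 : r ≠ 0 := by
    intro h
    simp [h] at hr
  -- The Gamma density of `Z²` multiplied by `exp(w y)`; the factor `2 * x ^ (2 - 1)` below is the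
  -- Jacobian of `y = x²`.
  let g : ℝ → ℂ := fun y => (((n + 1 : ℕ) : ℂ) ^ (n + 1) / (n.factorial * Ω ^ (n + 1))) *
    ((y : ℂ) ^ n * Complex.exp (-(r * y)))
  rw [integral_nakagamiMeasure hm hΩ]
  have hcongr : ∀ x ∈ Ioi (0 : ℝ), nakagamiPDFReal ((n + 1 : ℕ) : ℝ) Ω x •
      Complex.exp (w * x ^ 2) = (2 * x ^ ((2 : ℝ) - 1)) • g (x ^ (2 : ℝ)) := by
    intro x (hx : 0 < x)
    have h1 : x ^ (2 * ((n + 1 : ℕ) : ℝ) - 1) = x * (x ^ 2) ^ n := by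
      rw [show 2 * ((n + 1 : ℕ) : ℝ) - 1 = ((2 * n + 1 : ℕ) : ℝ) by push_cast; ring,
        Real.rpow_natCast]
      ring
    have h2 : Real.Gamma ((n + 1 : ℕ) : ℝ) = n.factorial := by
      rw [Nat.cast_succ, Real.Gamma_nat_eq_factorial]
    have h3 : Complex.exp (-(r * ((x ^ 2 : ℝ) : ℂ))) =
        (Real.exp (-(((n + 1 : ℕ) : ℝ) / Ω) * x ^ 2) : ℂ) * Complex.exp (w * x ^ 2) := by
      rw [Complex.ofReal_exp, ← Complex.exp_add, hrdef]
      congr 1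
      push_cast
      ring
    simp only [g]
    rw [nakagamiPDFReal, if_pos hx, h1, h2, Real.rpow_natCast, Real.rpow_natCast,
      Real.rpow_two, show (2 : ℝ) - 1 = 1 by norm_num, Real.rpow_one, h3, Complex.real_smul,
      Complex.real_smul]
    push_cast
    ring
  rw [setIntegral_congr_fun measurableSet_Ioi hcongr, integral_comp_rpow_Ioi_of_pos two_pos,
    integral_const_mul, integral_pow_mul_cexp_neg_mul n hr]
  have h4 : 1 - w * (Ω / (n + 1 : ℕ)) = r * (Ω / (n + 1 : ℕ)) := by
    rw [hrdef]
    field_simp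
  have hfac : (n.factorial : ℂ) ≠ 0 := by exact_mod_cast n.factorial_ne_zero
  rw [h4, mul_pow, div_pow]
  field_simp

/-! ### The shadowed-Rician characteristic function -/

lemma one_sub_mul_I_ne_zero (a : ℝ) : (1 - a * Complex.I : ℂ) ≠ 0 := by
  intro h
  have := congrArg Complex.re h
  simp at this

/-- The characteristic function of the shadowed-Rician distribution with integer shape. -/
lemma charFun_shadowedRicianMeasure (n : ℕ) {Ω σ2 p q : ℝ} (hΩ : 0 < Ω) (hσ : 0 < σ2)
    (hpq : p ^ 2 + q ^ 2 = 1) (t : ℝ) :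
    charFun (shadowedRicianMeasure ((n + 1 : ℕ) : ℝ) Ω σ2 p q) t =
      (1 - (σ2 * t : ℝ) * Complex.I) ^ n /
        (1 - ((σ2 + Ω / (n + 1 : ℕ)) * t : ℝ) * Complex.I) ^ (n + 1) := by
  have hm : (0 : ℝ) < (n + 1 : ℕ) := by positivity
  have := isFiniteMeasure_nakagamiMeasure hm hΩ
  set v : NNReal := (σ2 / 2).toNNReal with hvdef
  have hvr : (v : ℝ) = σ2 / 2 := Real.coe_toNNReal _ (by positivity)
  have hv : v ≠ 0 := by
    rw [← NNReal.coe_ne_zero, hvr]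
    positivity
  obtain ⟨A, hA, hG⟩ := exists_integral_cexp_sq_gaussianReal hv t
  have hvC : (2 * (v : ℝ) * t : ℂ) = (σ2 * t : ℝ) := by
    rw [hvr]
    push_cast
    ring
  rw [hvC] at hA hG
  set D : ℂ := 1 - (σ2 * t : ℝ) * Complex.I with hD
  have hD0 : D ≠ 0 := one_sub_mul_I_ne_zero _
  set w : ℂ := t * Complex.I / D with hw
  -- `Re w = -σ²t² / |D|²`, so the Nakagami Laplace transform applies at `w`.
  have hwre : w.re ≤ 0 := by
    have : w.re = -(t * (σ2 * t)) / Complex.normSq D := by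
      rw [hw, Complex.div_re]
      simp [hD]
    rw [this]
    apply div_nonpos_of_nonpos_of_nonneg _ (Complex.normSq_nonneg _)
    nlinarith [mul_nonneg hσ.le (sq_nonneg t)]
  rw [charFun_apply_real, shadowedRicianMeasure, integral_map (by fun_prop) (by fun_prop)]
  have hint : Integrable (fun v : (ℝ × ℝ) × ℝ => Complex.exp
      (t * (((v.1.1 + v.2 * p) ^ 2 + (v.1.2 + v.2 * q) ^ 2 : ℝ) : ℂ) * Complex.I))
      (((gaussianReal 0 v).prod (gaussianReal 0 v)).prod
        (nakagamiMeasure ((n + 1 : ℕ) : ℝ) Ω)) := by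
    refine Integrable.of_bound (by fun_prop) 1 (ae_of_all _ fun v => ?_)
    rw [← Complex.ofReal_mul, Complex.norm_exp_ofReal_mul_I]
  rw [integral_prod_symm _ hint]
  -- The direction enters only through `p² + q² = 1`, so all the `X i` share one law.
  have hinner : ∀ z : ℝ, ∫ u : ℝ × ℝ, Complex.exp
      (t * (((u.1 + z * p) ^ 2 + (u.2 + z * q) ^ 2 : ℝ) : ℂ) * Complex.I)
      ∂((gaussianReal 0 v).prod (gaussianReal 0 v)) = 1 / D * Complex.exp (w * z ^ 2) := by
    intro z
    have hsplit : ∀ u : ℝ × ℝ, Complex.exp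
        (t * (((u.1 + z * p) ^ 2 + (u.2 + z * q) ^ 2 : ℝ) : ℂ) * Complex.I) =
        Complex.exp (t * (u.1 + (z * p : ℝ)) ^ 2 * Complex.I) *
          Complex.exp (t * (u.2 + (z * q : ℝ)) ^ 2 * Complex.I) := by
      intro u
      rw [← Complex.exp_add]
      congr 1
      push_cast
      ring
    have hpqC : (p : ℂ) ^ 2 + q ^ 2 = 1 := by exact_mod_cast hpq
    simp_rw [hsplit]
    rw [integral_prod_mul (fun x : ℝ => Complex.exp (t * (x + (z * p : ℝ)) ^ 2 * Complex.I))
      (fun x : ℝ => Complex.exp (t * (x + (z * q : ℝ)) ^ 2 * Complex.I)), hG, hG,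
      mul_mul_mul_comm, ← sq, hA, ← Complex.exp_add]
    congr 2
    rw [hw]
    push_cast
    linear_combination (t * Complex.I * z ^ 2 / D) * hpqC
  simp_rw [hinner]
  rw [integral_const_mul, integral_cexp_mul_sq_nakagamiMeasure n hΩ hwre]
  have hE : 1 - w * (Ω / (n + 1 : ℕ)) =
      (1 - ((σ2 + Ω / (n + 1 : ℕ)) * t : ℝ) * Complex.I) / D := by
    rw [eq_div_iff hD0, sub_mul, hw, div_mul_eq_mul_div, div_mul_cancel₀ _ hD0, hD]
    push_cast
    ring
  rw [hE, div_pow, one_div_div, ← mul_div_assoc, pow_succ' D n, ← mul_assoc, one_div,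
    inv_mul_cancel₀ hD0, one_mul]

/-! ### Gamma laws with integer shape -/

lemma gammaPDFReal_natCast_succ (n : ℕ) (r : ℝ) {x : ℝ} (hx : 0 ≤ x) :
    gammaPDFReal ((n + 1 : ℕ) : ℝ) r x =
      r ^ (n + 1) / n.factorial * (x ^ n * Real.exp (-(r * x))) := by
  rw [gammaPDFReal, if_pos hx, Real.rpow_natCast, Nat.cast_succ, add_sub_cancel_right,
    Real.rpow_natCast, Real.Gamma_nat_eq_factorial, mul_assoc]

lemma measurable_gammaPDF (a r : ℝ) : Measurable (gammaPDF a r) :=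
  (measurable_gammaPDFReal a r).ennreal_ofReal

lemma toReal_gammaPDF_smul_ae {E : Type*} [NormedAddCommGroup E] [NormedSpace ℝ E] (n : ℕ) {r : ℝ}
    (hr : 0 < r) (f : ℝ → E) :
    (fun x => (gammaPDF ((n + 1 : ℕ) : ℝ) r x).toReal • f x) =ᵐ[volume]
      (Ioi (0 : ℝ)).indicator fun x =>
        (r ^ (n + 1) / n.factorial) • ((x ^ n * Real.exp (-(r * x))) • f x) := by
  -- The Gamma density is supported on `0 ≤ x`, and for shape `1` it is nonzero at `0`, so the
  -- identity holds only off the origin.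
  have h0 : ∀ᵐ x : ℝ, x ≠ 0 := by simp [ae_iff]
  filter_upwards [h0] with x hx
  rw [gammaPDF, ENNReal.toReal_ofReal (gammaPDFReal_nonneg (by positivity) hr x)]
  rcases lt_or_gt_of_ne hx with h | h
  · simp [indicator, h.not_gt, gammaPDFReal, h.not_ge]
  · simp only [indicator, mem_Ioi, h, if_true]
    rw [gammaPDFReal_natCast_succ n r h.le, mul_smul]

lemma integral_gammaMeasure_natCast_succ {E : Type*} [NormedAddCommGroup E] [NormedSpace ℝ E]
    (n : ℕ) {r : ℝ} (hr : 0 < r) (f : ℝ → E) :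
    ∫ x, f x ∂(gammaMeasure ((n + 1 : ℕ) : ℝ) r) =
      (r ^ (n + 1) / n.factorial) •
        ∫ x in Ioi (0 : ℝ), (x ^ n * Real.exp (-(r * x))) • f x := by
  rw [gammaMeasure, integral_withDensity_eq_integral_toReal_smul
    (measurable_gammaPDF _ _) (ae_of_all _ fun _ => ENNReal.ofReal_lt_top),
    integral_congr_ae (toReal_gammaPDF_smul_ae n hr f), integral_indicator measurableSet_Ioi,
    integral_smul]

lemma integrable_pow_gammaMeasure (n j : ℕ) {r : ℝ} (hr : 0 < r) :
    Integrable (fun x : ℝ => x ^ j) (gammaMeasure ((n + 1 : ℕ) : ℝ) r) := by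
  rw [gammaMeasure, integrable_withDensity_iff_integrable_smul'
    (measurable_gammaPDF _ _) (ae_of_all _ fun _ => ENNReal.ofReal_lt_top),
    integrable_congr (toReal_gammaPDF_smul_ae n hr _), integrable_indicator_iff measurableSet_Ioi]
  refine Integrable.smul (r ^ (n + 1) / n.factorial : ℝ) ((integrableOn_pow_mul_exp_neg_mul (n + j) hr).congr ?_)
  refine ae_of_all _ fun x => ?_
  simp only [smul_eq_mul]
  ring

lemma integral_pow_gammaMeasure (n j : ℕ) {r : ℝ} (hr : 0 < r) :
    ∫ x, x ^ j ∂(gammaMeasure ((n + 1 : ℕ) : ℝ) r) =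
      (n + j).factorial / (n.factorial * r ^ j) := by
  have h : ∀ x : ℝ, (x ^ n * Real.exp (-(r * x))) • x ^ j =
      x ^ (n + j) * Real.exp (-(r * x)) := fun x => by
    rw [smul_eq_mul]
    ring
  rw [integral_gammaMeasure_natCast_succ n hr]
  simp_rw [h]
  rw [integral_pow_mul_exp_neg_mul _ hr, smul_eq_mul, pow_add r (n + j) 1, pow_add r n j, pow_succ]
  field_simp

lemma charFun_gammaMeasure (n : ℕ) {r : ℝ} (hr : 0 < r) (t : ℝ) :
    charFun (gammaMeasure ((n + 1 : ℕ) : ℝ) r) t =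
      1 / (1 - (r⁻¹ * t : ℝ) * Complex.I) ^ (n + 1) := by
  have hre : 0 < ((r : ℂ) - t * Complex.I).re := by simpa using hr
  have h : ∀ x : ℝ, (x ^ n * Real.exp (-(r * x))) • Complex.exp (t * x * Complex.I) =
      (x : ℂ) ^ n * Complex.exp (-((r - t * Complex.I) * x)) := fun x => by
    rw [Complex.real_smul, Complex.ofReal_mul, Complex.ofReal_exp, mul_assoc, ← Complex.exp_add,
      Complex.ofReal_pow]
    congr 2
    push_cast
    ring
  rw [charFun_apply_real, integral_gammaMeasure_natCast_succ n hr]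
  simp_rw [h]
  have hrC : (r : ℂ) ≠ 0 := by exact_mod_cast hr.ne'
  have hfac : (n.factorial : ℂ) ≠ 0 := by exact_mod_cast n.factorial_ne_zero
  have h2 : (r : ℂ) - t * Complex.I = r * (1 - (r⁻¹ * t : ℝ) * Complex.I) := by
    push_cast
    field_simp
  rw [integral_pow_mul_cexp_neg_mul n hre, Complex.real_smul, h2, mul_pow]
  push_cast
  field_simp

/-- The distribution function of a Gamma law with integer shape. -/
lemma gammaMeasure_real_Iic (n : ℕ) {r x : ℝ} (hr : 0 < r) (hx : 0 < x) :
    (gammaMeasure ((n + 1 : ℕ) : ℝ) r).real (Iic x) =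
      lowerGamma ((n + 1 : ℕ) : ℝ) (r * x) / n.factorial := by
  have hn : (0 : ℝ) < (n + 1 : ℕ) := by positivity
  have := isProbabilityMeasure_gammaMeasure hn hr
  rw [← cdf_eq_real, cdf_gammaMeasure_eq_integral hn hr]
  have h1 : ∫ y in Iic x, gammaPDFReal ((n + 1 : ℕ) : ℝ) r y =
      ∫ y in Ioc 0 x, gammaPDFReal ((n + 1 : ℕ) : ℝ) r y := by
    rw [← integral_Icc_eq_integral_Ioc]
    refine setIntegral_eq_of_subset_of_forall_sdiff_eq_zero measurableSet_Iic
      Icc_subset_Iic_self fun y hy => ?_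
    have : ¬ 0 ≤ y := fun h => hy.2 ⟨h, hy.1⟩
    simp [gammaPDFReal, this]
  rw [h1, ← intervalIntegral.integral_of_le hx.le, lowerGamma]
  have h2 := intervalIntegral.integral_comp_mul_left (a := 0) (b := x)
    (fun s : ℝ => s ^ n * Real.exp (-s)) hr.ne'
  rw [mul_zero] at h2
  have h3 : ∫ s in (0 : ℝ)..(r * x), s ^ (((n + 1 : ℕ) : ℝ) - 1) * Real.exp (-s) =
      r * ∫ y in (0 : ℝ)..x, (r * y) ^ n * Real.exp (-(r * y)) := by
    rw [h2, smul_eq_mul, mul_inv_cancel_left₀ hr.ne']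
    simp
  rw [h3, mul_div_right_comm, ← intervalIntegral.integral_const_mul]
  refine intervalIntegral.integral_congr fun y hy => ?_
  rw [uIcc_of_le hx.le] at hy
  simp only [gammaPDFReal_natCast_succ n r hy.1]
  ring

/-- The closed form of the lower incomplete Gamma function at integer shape. -/
lemma lowerGamma_natCast_succ (n : ℕ) (x : ℝ) :
    lowerGamma ((n + 1 : ℕ) : ℝ) x / n.factorial =
      1 - ∑ j ∈ Finset.range (n + 1), x ^ j / j.factorial * Real.exp (-x) := by
  -- The derivatives of the summands telescope, leaving only the top-degree term.
  have hd : ∀ (n : ℕ) (y : ℝ), HasDerivAt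
      (fun y : ℝ => -∑ j ∈ Finset.range (n + 1), y ^ j / j.factorial * Real.exp (-y))
      (y ^ n * Real.exp (-y) / n.factorial) y := by
    intro n y
    induction n with
    | zero => simpa using (hasDerivAt_neg y).exp.fun_neg
    | succ n ih =>
      simp_rw [Finset.sum_range_succ _ (n + 1), neg_add]
      refine (ih.add (((hasDerivAt_pow (n + 1) y).div_const _).mul
        (hasDerivAt_neg y).exp).neg).congr_deriv ?_
      rw [Nat.factorial_succ]
      push_cast
      field_simp
      ring
  have h := intervalIntegral.integral_eq_sub_of_hasDerivAt (a := 0) (b := x)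
    (fun y _ => hd n y) ((by fun_prop : Continuous _).intervalIntegrable _ _)
  rw [intervalIntegral.integral_div] at h
  have h0 : ∑ j ∈ Finset.range (n + 1), (0 : ℝ) ^ j / j.factorial * Real.exp (-0) = 1 := by
    rw [Finset.sum_range_succ']
    simp
  rw [h0] at h
  simp only [lowerGamma, Nat.cast_succ, add_sub_cancel_right, Real.rpow_natCast]
  rw [h]
  ring

/-! ### Parameters and mixture weights -/

lemma kappa_add_one {σ2 : ℝ} (hσ : 0 < σ2) : kappa σ2 + 1 = 1 / σ2 := by
  rw [kappa]
  field_simp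
  ring

/-- `κ` cancels in `κω`; `σ² ≠ 1` serves to make it nonzero. -/
lemma xi_eq (ψ : ℕ) (Ω : ℝ) {σ2 : ℝ} (hσ : 0 < σ2) (hσ1 : σ2 ≠ 1) :
    xi ψ Ω σ2 = Ω / (σ2 * ψ) := by
  have hκ : kappa σ2 ≠ 0 := div_ne_zero (sub_ne_zero.mpr hσ1.symm) hσ.ne'
  rw [xi, omega, mul_div_cancel₀ _ hκ, kappa_add_one hσ]
  field_simp

lemma alpha_eq (ψ : ℕ) (Ω : ℝ) {σ2 : ℝ} (hσ : 0 < σ2) (hσ1 : σ2 ≠ 1) :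
    alpha ψ Ω σ2 = σ2 + Ω / ψ := by
  rw [alpha, kappa_add_one hσ, xi_eq ψ Ω hσ hσ1, ← div_div]
  field_simp
  ring

lemma xi_pos {ψ : ℕ} (hψ : 1 ≤ ψ) {Ω σ2 : ℝ} (hΩ : 0 < Ω) (hσ : 0 < σ2) (hσ1 : σ2 ≠ 1) :
    0 < xi ψ Ω σ2 := by
  rw [xi_eq ψ Ω hσ hσ1]
  have : (0 : ℝ) < ψ := by exact_mod_cast hψ
  positivity

lemma alpha_pos (ψ : ℕ) {Ω σ2 : ℝ} (hΩ : 0 < Ω) (hσ : 0 < σ2) (hσ1 : σ2 ≠ 1) :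
    0 < alpha ψ Ω σ2 := by
  rw [alpha_eq ψ Ω hσ hσ1]
  positivity

lemma chi_nonneg (I : ℕ) {ψ : ℕ} (hψ : 1 ≤ ψ) {Ω σ2 : ℝ} (hΩ : 0 < Ω) (hσ : 0 < σ2)
    (hσ1 : σ2 ≠ 1) (k : ℕ) : 0 ≤ chi I ψ Ω σ2 k := by
  have := xi_pos hψ hΩ hσ hσ1
  unfold chi
  positivity

/-- The weights are binomial probabilities with success probability `1/(ξ+1)`, so the Bernstein
identities supply their total mass and first two moments. -/
lemma chi_eq_eval_bernsteinPolynomial (I ψ : ℕ) {Ω σ2 : ℝ} (hξ : 0 < xi ψ Ω σ2) (k : ℕ) :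
    chi I ψ Ω σ2 k =
      (bernsteinPolynomial ℝ (I * ψ - I) k).eval (1 / (xi ψ Ω σ2 + 1)) := by
  have h : xi ψ Ω σ2 / (xi ψ Ω σ2 + 1) = 1 - 1 / (xi ψ Ω σ2 + 1) := by
    field_simp
    ring
  simp only [chi, bernsteinPolynomial, Polynomial.eval_mul, Polynomial.eval_natCast,
    Polynomial.eval_pow, Polynomial.eval_X, Polynomial.eval_sub, Polynomial.eval_one, h, div_pow,
    one_pow]

lemma sum_chi (I ψ : ℕ) {Ω σ2 : ℝ} (hξ : 0 < xi ψ Ω σ2) :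
    ∑ k ∈ Finset.range (I * ψ - I + 1), chi I ψ Ω σ2 k = 1 := by
  simp_rw [chi_eq_eval_bernsteinPolynomial I ψ hξ]
  rw [← Polynomial.eval_finsetSum, bernsteinPolynomial.sum, Polynomial.eval_one]

lemma sum_chi_mul (I ψ : ℕ) {Ω σ2 : ℝ} (hξ : 0 < xi ψ Ω σ2) :
    ∑ k ∈ Finset.range (I * ψ - I + 1), chi I ψ Ω σ2 k * k =
      (I * ψ - I : ℕ) * (1 / (xi ψ Ω σ2 + 1)) := by
  have h := congrArg (Polynomial.eval (1 / (xi ψ Ω σ2 + 1)))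
    (bernsteinPolynomial.sum_smul ℝ (I * ψ - I))
  simp only [Polynomial.eval_finsetSum, nsmul_eq_mul, Polynomial.eval_mul,
    Polynomial.eval_natCast, Polynomial.eval_X, ← chi_eq_eval_bernsteinPolynomial I ψ hξ] at h
  simpa only [mul_comm] using h

lemma natCast_mul_pred (n : ℕ) : ((n * (n - 1) : ℕ) : ℝ) = n * (n - 1) := by
  cases n <;> simp

lemma sum_chi_mul_sq (I ψ : ℕ) {Ω σ2 : ℝ} (hξ : 0 < xi ψ Ω σ2) :
    ∑ k ∈ Finset.range (I * ψ - I + 1), chi I ψ Ω σ2 k * k ^ 2 =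
      (I * ψ - I : ℕ) * ((I * ψ - I : ℕ) - 1) * (1 / (xi ψ Ω σ2 + 1)) ^ 2 +
        (I * ψ - I : ℕ) * (1 / (xi ψ Ω σ2 + 1)) := by
  have h := congrArg (Polynomial.eval (1 / (xi ψ Ω σ2 + 1)))
    (bernsteinPolynomial.sum_mul_smul ℝ (I * ψ - I))
  simp only [Polynomial.eval_finsetSum, nsmul_eq_mul, Polynomial.eval_mul, Polynomial.eval_pow,
    Polynomial.eval_natCast, Polynomial.eval_X, ← chi_eq_eval_bernsteinPolynomial I ψ hξ,
    natCast_mul_pred] at h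
  rw [← h, ← sum_chi_mul I ψ hξ, ← Finset.sum_add_distrib]
  refine Finset.sum_congr rfl fun k _ => ?_
  ring

/-- In the range of summation `Iψ - k ≥ I ≥ 1`, so truncated subtraction loses nothing. -/
lemma pred_shape_add_one {I ψ k : ℕ} (hI : 1 ≤ I) (hψ : 1 ≤ ψ)
    (hk : k ∈ Finset.range (I * ψ - I + 1)) : I * ψ - k - 1 + 1 = I * ψ - k := by
  have h1 : I ≤ I * ψ := Nat.le_mul_of_pos_right I hψ
  have := Finset.mem_range.mp hk
  omega

/-! ### The mixture and the law of the sum -/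

/-- The density `sisrPDFReal` is that of a binomial mixture of Gamma laws. -/
lemma withDensity_sisrPDFReal {I ψ : ℕ} (hI : 1 ≤ I) (hψ : 1 ≤ ψ) {Ω σ2 : ℝ} (hΩ : 0 < Ω)
    (hσ : 0 < σ2) (hσ1 : σ2 ≠ 1) :
    (volume.withDensity fun x => ENNReal.ofReal (sisrPDFReal I ψ Ω σ2 x)) =
      ∑ k ∈ Finset.range (I * ψ - I + 1), ENNReal.ofReal (chi I ψ Ω σ2 k) •
        gammaMeasure ((I * ψ - k - 1 + 1 : ℕ) : ℝ) (alpha ψ Ω σ2)⁻¹ := by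
  have hα := alpha_pos ψ hΩ hσ hσ1
  have hχ := chi_nonneg I hψ hΩ hσ hσ1
  have hae : (fun x => ENNReal.ofReal (sisrPDFReal I ψ Ω σ2 x)) =ᵐ[volume] fun x =>
      ∑ k ∈ Finset.range (I * ψ - I + 1), ENNReal.ofReal (chi I ψ Ω σ2 k) *
        gammaPDF ((I * ψ - k - 1 + 1 : ℕ) : ℝ) (alpha ψ Ω σ2)⁻¹ x := by
    have h0 : ∀ᵐ x : ℝ, x ≠ 0 := by simp [ae_iff]
    filter_upwards [h0] with x hx
    simp_rw [gammaPDF, ← ENNReal.ofReal_mul (hχ _)]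
    rw [← ENNReal.ofReal_sum_of_nonneg fun k _ => mul_nonneg (hχ k)
      (gammaPDFReal_nonneg (by positivity) (inv_pos.mpr hα) x)]
    congr 1
    rcases lt_or_gt_of_ne hx with h | h
    · simp [sisrPDFReal, h.not_gt, gammaPDFReal, h.not_ge]
    · rw [sisrPDFReal, if_pos h]
      refine Finset.sum_congr rfl fun k hk => ?_
      rw [gammaPDFReal_natCast_succ _ _ h.le, pred_shape_add_one hI hψ hk, inv_pow,
        show -((alpha ψ Ω σ2)⁻¹ * x) = -x / alpha ψ Ω σ2 by ring]
      field_simp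
  rw [withDensity_congr_ae hae]
  ext s hs
  rw [withDensity_apply _ hs, lintegral_finsetSum _
    fun k _ => (measurable_gammaPDF _ _).const_mul _, Measure.finsetSum_apply]
  refine Finset.sum_congr rfl fun k _ => ?_
  rw [lintegral_const_mul _ (measurable_gammaPDF _ _), Measure.smul_apply, gammaMeasure,
    withDensity_apply _ hs, smul_eq_mul]

/-- Integration against a finite mixture of measures. -/
lemma integral_sum_ofReal_smul_measure {E : Type*} [NormedAddCommGroup E] [NormedSpace ℝ E] {ι : Type*}
    {s : Finset ι} {c : ι → ℝ} (hc : ∀ i, 0 ≤ c i) {μ : ι → Measure ℝ} {f : ℝ → E}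
    (hf : ∀ i ∈ s, Integrable f (μ i)) :
    ∫ x, f x ∂(∑ i ∈ s, ENNReal.ofReal (c i) • μ i) = ∑ i ∈ s, c i • ∫ x, f x ∂(μ i) := by
  rw [integral_finsetSum_measure fun i hi => (hf i hi).smul_measure ENNReal.ofReal_ne_top]
  refine Finset.sum_congr rfl fun i _ => ?_
  rw [integral_smul_measure, ENNReal.toReal_ofReal (hc i)]

/-- The characteristic function of the binomial mixture of Gamma laws. -/
lemma charFun_withDensity_sisrPDFReal {I ψ : ℕ} (hI : 1 ≤ I) (hψ : 1 ≤ ψ) {Ω σ2 : ℝ} (hΩ : 0 < Ω)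
    (hσ : 0 < σ2) (hσ1 : σ2 ≠ 1) (t : ℝ) :
    charFun (volume.withDensity fun x => ENNReal.ofReal (sisrPDFReal I ψ Ω σ2 x)) t =
      (1 - (σ2 * t : ℝ) * Complex.I) ^ (I * ψ - I) /
        (1 - (alpha ψ Ω σ2 * t : ℝ) * Complex.I) ^ (I * ψ) := by
  have hα := alpha_pos ψ hΩ hσ hσ1
  have hα' : 0 < (alpha ψ Ω σ2)⁻¹ := inv_pos.mpr hα
  have hξ := xi_pos hψ hΩ hσ hσ1
  have hle : I ≤ I * ψ := Nat.le_mul_of_pos_right I hψ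
  set E : ℂ := 1 - (alpha ψ Ω σ2 * t : ℝ) * Complex.I with hE
  have hE0 : E ≠ 0 := one_sub_mul_I_ne_zero _
  rw [withDensity_sisrPDFReal hI hψ hΩ hσ hσ1, charFun_apply_real,
    integral_sum_ofReal_smul_measure (chi_nonneg I hψ hΩ hσ hσ1)]
  -- The convex combination whose binomial expansion produces the weights; each `E^k` then cancels
  -- against `E^(Iψ)`.
  · have hD : 1 - (σ2 * t : ℝ) * Complex.I =
        ((1 / (xi ψ Ω σ2 + 1) : ℝ) : ℂ) * E + ((xi ψ Ω σ2 / (xi ψ Ω σ2 + 1) : ℝ) : ℂ) := by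
      have h1 : (1 / (xi ψ Ω σ2 + 1)) * alpha ψ Ω σ2 = σ2 := by
        rw [alpha, kappa_add_one hσ]
        field_simp
      have h2 : xi ψ Ω σ2 / (xi ψ Ω σ2 + 1) = 1 - 1 / (xi ψ Ω σ2 + 1) := by
        field_simp
        ring
      have h3 : ((1 / (xi ψ Ω σ2 + 1) : ℝ) : ℂ) * (alpha ψ Ω σ2 : ℝ) = (σ2 : ℝ) := by
        exact_mod_cast h1
      rw [h2, hE, Complex.ofReal_sub, Complex.ofReal_mul, Complex.ofReal_mul, ← h3]
      push_cast
      ring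
    rw [hD, add_pow, Finset.sum_div]
    refine Finset.sum_congr rfl fun k hk => ?_
    have hk' := Finset.mem_range.mp hk
    rw [← charFun_apply_real, charFun_gammaMeasure _ hα', inv_inv, ← hE,
      pred_shape_add_one hI hψ hk, Complex.real_smul, chi,
      show E ^ (I * ψ) = E ^ (I * ψ - k) * E ^ k by rw [← pow_add]; congr 1; omega, mul_pow]
    push_cast
    rw [div_pow 1, one_pow]
    field_simp
  · intro k _
    have := isProbabilityMeasure_gammaMeasure
      (by positivity : (0 : ℝ) < (I * ψ - k - 1 + 1 : ℕ)) hα'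
    refine Integrable.of_bound (by fun_prop) 1 (ae_of_all _ fun x => ?_)
    rw [← Complex.ofReal_mul, Complex.norm_exp_ofReal_mul_I]

/-- The sum of independent shadowed-Rician variables has density `sisrPDFReal`. -/
lemma hasLaw_sum_shadowedRician {S : Type*} [MeasurableSpace S] {P : Measure S}
    [IsProbabilityMeasure P] {I ψ : ℕ} (hI : 1 ≤ I) (hψ : 1 ≤ ψ) {Ω σ2 : ℝ} (hΩ : 0 < Ω)
    (hσ : 0 < σ2) (hσ1 : σ2 ≠ 1) {p q : Fin I → ℝ} (hpq : ∀ i, p i ^ 2 + q i ^ 2 = 1)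
    {X : Fin I → S → ℝ} (hX : iIndepFun X P)
    (hlaw : ∀ i, HasLaw (X i) (shadowedRicianMeasure ψ Ω σ2 (p i) (q i)) P) :
    HasLaw (fun s => ∑ i, X i s)
      (volume.withDensity fun x => ENNReal.ofReal (sisrPDFReal I ψ Ω σ2 x)) P := by
  have hXm : ∀ i, AEMeasurable (X i) P := fun i => (hlaw i).aemeasurable
  refine ⟨Finset.aemeasurable_fun_sum _ fun i _ => hXm i, ?_⟩
  have hfin : IsFiniteMeasure
      (volume.withDensity fun x => ENNReal.ofReal (sisrPDFReal I ψ Ω σ2 x)) := by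
    rw [withDensity_sisrPDFReal hI hψ hΩ hσ hσ1]
    have : ∀ k, IsFiniteMeasure (ENNReal.ofReal (chi I ψ Ω σ2 k) •
        gammaMeasure ((I * ψ - k - 1 + 1 : ℕ) : ℝ) (alpha ψ Ω σ2)⁻¹) := fun k => by
      have := isProbabilityMeasure_gammaMeasure
        (by positivity : (0 : ℝ) < (I * ψ - k - 1 + 1 : ℕ))
        (inv_pos.mpr (alpha_pos ψ hΩ hσ hσ1))
      exact Measure.smul_finite _ ENNReal.ofReal_ne_top
    infer_instance
  refine Measure.ext_of_charFun ?_
  ext t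
  rw [iIndepFun.charFun_map_fun_sum_eq_prod hXm hX, Finset.prod_apply,
    charFun_withDensity_sisrPDFReal hI hψ hΩ hσ hσ1]
  obtain ⟨n, rfl⟩ : ∃ n, ψ = n + 1 := ⟨ψ - 1, by omega⟩
  simp_rw [fun i => (hlaw i).map_eq, fun i => charFun_shadowedRicianMeasure n hΩ hσ (hpq i) t]
  rw [Finset.prod_const, Finset.card_univ, Fintype.card_fin, div_pow, ← pow_mul, ← pow_mul,
    alpha_eq _ Ω hσ hσ1, show I * (n + 1) - I = n * I by rw [mul_add, mul_one, Nat.add_sub_cancel,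
    mul_comm], mul_comm I]

/-! ### Moments -/

lemma natCast_shape {I ψ k : ℕ} (hψ : 1 ≤ ψ) (hk : k ∈ Finset.range (I * ψ - I + 1)) :
    ((I * ψ - k : ℕ) : ℝ) = I * ψ - k := by
  have h1 : I ≤ I * ψ := Nat.le_mul_of_pos_right I hψ
  have := Finset.mem_range.mp hk
  rw [Nat.cast_sub (by omega)]
  push_cast
  rfl

lemma integrable_pow_withDensity_sisrPDFReal {I ψ : ℕ} (hI : 1 ≤ I) (hψ : 1 ≤ ψ) {Ω σ2 : ℝ}
    (hΩ : 0 < Ω) (hσ : 0 < σ2) (hσ1 : σ2 ≠ 1) (j : ℕ) :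
    Integrable (fun x : ℝ => x ^ j)
      (volume.withDensity fun x => ENNReal.ofReal (sisrPDFReal I ψ Ω σ2 x)) := by
  rw [withDensity_sisrPDFReal hI hψ hΩ hσ hσ1, integrable_finsetSum_measure]
  exact fun k _ => (integrable_pow_gammaMeasure _ j
    (inv_pos.mpr (alpha_pos ψ hΩ hσ hσ1))).smul_measure ENNReal.ofReal_ne_top

lemma integral_pow_withDensity_sisrPDFReal {I ψ : ℕ} (hI : 1 ≤ I) (hψ : 1 ≤ ψ) {Ω σ2 : ℝ}
    (hΩ : 0 < Ω) (hσ : 0 < σ2) (hσ1 : σ2 ≠ 1) (j : ℕ) :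
    ∫ x, x ^ j ∂(volume.withDensity fun x => ENNReal.ofReal (sisrPDFReal I ψ Ω σ2 x)) =
      ∑ k ∈ Finset.range (I * ψ - I + 1), chi I ψ Ω σ2 k *
        ((I * ψ - k - 1 + j).factorial / (I * ψ - k - 1).factorial * alpha ψ Ω σ2 ^ j) := by
  have hα' := inv_pos.mpr (alpha_pos ψ hΩ hσ hσ1)
  rw [withDensity_sisrPDFReal hI hψ hΩ hσ hσ1,
    integral_sum_ofReal_smul_measure (chi_nonneg I hψ hΩ hσ hσ1)
      fun k _ => integrable_pow_gammaMeasure _ j hα']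
  refine Finset.sum_congr rfl fun k _ => ?_
  rw [integral_pow_gammaMeasure _ j hα', smul_eq_mul, inv_pow, ← div_div, div_inv_eq_mul]

lemma one_div_xi_add_one {ψ : ℕ} (hψ : 1 ≤ ψ) {Ω σ2 : ℝ} (hΩ : 0 < Ω) (hσ : 0 < σ2)
    (hσ1 : σ2 ≠ 1) : 1 / (xi ψ Ω σ2 + 1) = σ2 / (σ2 + Ω / ψ) := by
  have : (0 : ℝ) < ψ := by exact_mod_cast hψ
  rw [xi_eq ψ Ω hσ hσ1]
  field_simp
  ring

lemma natCast_mul_sub_self (I : ℕ) {ψ : ℕ} (hψ : 1 ≤ ψ) :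
    ((I * ψ - I : ℕ) : ℝ) = I * ψ - I := by
  rw [Nat.cast_sub (Nat.le_mul_of_pos_right I hψ)]
  push_cast
  rfl

/-- The first moment. -/
lemma integral_id_withDensity_sisrPDFReal {I ψ : ℕ} (hI : 1 ≤ I) (hψ : 1 ≤ ψ) {Ω σ2 : ℝ}
    (hΩ : 0 < Ω) (hσ : 0 < σ2) (hσ1 : σ2 ≠ 1) :
    ∫ x, x ∂(volume.withDensity fun x => ENNReal.ofReal (sisrPDFReal I ψ Ω σ2 x)) =
      I * (σ2 + Ω) := by
  have hξ := xi_pos hψ hΩ hσ hσ1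
  have hψ0 : (0 : ℝ) < ψ := by exact_mod_cast hψ
  have h := integral_pow_withDensity_sisrPDFReal hI hψ hΩ hσ hσ1 1
  simp only [pow_one] at h
  rw [h]
  -- The factorial ratio is the shape `Iψ - k`, so only the mean of the weights is needed.
  have h1 : ∀ k ∈ Finset.range (I * ψ - I + 1), chi I ψ Ω σ2 k *
      ((I * ψ - k - 1 + 1).factorial / (I * ψ - k - 1).factorial * alpha ψ Ω σ2) =
      alpha ψ Ω σ2 * (I * ψ) * chi I ψ Ω σ2 k - alpha ψ Ω σ2 * (chi I ψ Ω σ2 k * k) := by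
    intro k hk
    rw [Nat.factorial_succ, Nat.cast_mul, pred_shape_add_one hI hψ hk, natCast_shape hψ hk,
      mul_div_cancel_right₀ _ (by positivity)]
    ring
  rw [Finset.sum_congr rfl h1, Finset.sum_sub_distrib, ← Finset.mul_sum, ← Finset.mul_sum,
    sum_chi I ψ hξ, sum_chi_mul I ψ hξ, one_div_xi_add_one hψ hΩ hσ hσ1, alpha_eq ψ Ω hσ hσ1,
    natCast_mul_sub_self I hψ]
  field_simp
  ring

/-- The second moment. -/
lemma integral_sq_withDensity_sisrPDFReal {I ψ : ℕ} (hI : 1 ≤ I) (hψ : 1 ≤ ψ) {Ω σ2 : ℝ}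
    (hΩ : 0 < Ω) (hσ : 0 < σ2) (hσ1 : σ2 ≠ 1) :
    ∫ x, x ^ 2 ∂(volume.withDensity fun x => ENNReal.ofReal (sisrPDFReal I ψ Ω σ2 x)) =
      (I * (σ2 + Ω)) ^ 2 + I * (σ2 ^ 2 + 2 * σ2 * Ω + Ω ^ 2 / ψ) := by
  have hξ := xi_pos hψ hΩ hσ hσ1
  have hψ0 : (0 : ℝ) < ψ := by exact_mod_cast hψ
  rw [integral_pow_withDensity_sisrPDFReal hI hψ hΩ hσ hσ1]
  have h1 : ∀ k ∈ Finset.range (I * ψ - I + 1), chi I ψ Ω σ2 k *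
      ((I * ψ - k - 1 + 2).factorial / (I * ψ - k - 1).factorial * alpha ψ Ω σ2 ^ 2) =
      alpha ψ Ω σ2 ^ 2 * (I * ψ * (I * ψ + 1)) * chi I ψ Ω σ2 k -
        alpha ψ Ω σ2 ^ 2 * (2 * (I * ψ) + 1) * (chi I ψ Ω σ2 k * k) +
        alpha ψ Ω σ2 ^ 2 * (chi I ψ Ω σ2 k * k ^ 2) := by
    intro k hk
    rw [Nat.factorial_succ, Nat.factorial_succ, Nat.cast_mul, Nat.cast_mul, Nat.cast_succ,
      pred_shape_add_one hI hψ hk, natCast_shape hψ hk, ← mul_assoc ((I : ℝ) * ψ - k + 1),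
      mul_div_cancel_right₀ _ (by positivity)]
    ring
  rw [Finset.sum_congr rfl h1, Finset.sum_add_distrib, Finset.sum_sub_distrib, ← Finset.mul_sum,
    ← Finset.mul_sum, ← Finset.mul_sum, sum_chi I ψ hξ, sum_chi_mul I ψ hξ, sum_chi_mul_sq I ψ hξ,
    one_div_xi_add_one hψ hΩ hσ hσ1, alpha_eq ψ Ω hσ hσ1, natCast_mul_sub_self I hψ]
  field_simp
  ring

/-! ### Distribution function -/

/-- The distribution function, through lower incomplete Gamma functions. -/
lemma withDensity_sisrPDFReal_real_Iic {I ψ : ℕ} (hI : 1 ≤ I) (hψ : 1 ≤ ψ) {Ω σ2 : ℝ}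
    (hΩ : 0 < Ω) (hσ : 0 < σ2) (hσ1 : σ2 ≠ 1) {x : ℝ} (hx : 0 < x) :
    (volume.withDensity fun x => ENNReal.ofReal (sisrPDFReal I ψ Ω σ2 x)).real (Iic x) =
      ∑ k ∈ Finset.range (I * ψ - I + 1), chi I ψ Ω σ2 k *
        (lowerGamma ((I * ψ - k - 1 + 1 : ℕ) : ℝ) (x / alpha ψ Ω σ2) /
          (I * ψ - k - 1).factorial) := by
  have hα' := inv_pos.mpr (alpha_pos ψ hΩ hσ hσ1)
  rw [withDensity_sisrPDFReal hI hψ hΩ hσ hσ1, measureReal_def, Measure.finsetSum_apply,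
    ENNReal.toReal_sum]
  · refine Finset.sum_congr rfl fun k _ => ?_
    rw [Measure.smul_apply, smul_eq_mul, ENNReal.toReal_mul,
      ENNReal.toReal_ofReal (chi_nonneg I hψ hΩ hσ hσ1 k), ← measureReal_def,
      gammaMeasure_real_Iic _ hα' hx, div_eq_inv_mul x]
  · intro k _
    have := isProbabilityMeasure_gammaMeasure
      (by positivity : (0 : ℝ) < (I * ψ - k - 1 + 1 : ℕ)) hα'
    exact ENNReal.mul_ne_top ENNReal.ofReal_ne_top (measure_ne_top _ _)

/-! ### Moment matching -/

/-- The method of moments: the first two moments determine `Ω` and `σ2`. -/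
lemma moments_eq_iff_matched {I ψ : ℕ} (hI : 1 ≤ I) (hψ : 2 ≤ ψ) {Ω σ2 : ℝ} (hΩ : 0 < Ω)
    (μ₁ μ₂ : ℝ) :
    (I * (σ2 + Ω) = μ₁ ∧
      (I * (σ2 + Ω)) ^ 2 + I * (σ2 ^ 2 + 2 * σ2 * Ω + Ω ^ 2 / ψ) = μ₂) ↔
      (Ω = matchedOmega I ψ μ₁ μ₂ ∧ σ2 = matchedSigmaSq I ψ μ₁ μ₂) := by
  have hI0 : (0 : ℝ) < I := by exact_mod_cast hI
  have hψ2 : (2 : ℝ) ≤ ψ := by exact_mod_cast hψ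
  have hψ0 : (0 : ℝ) < ψ := by linarith
  have hψ1 : (0 : ℝ) < (ψ : ℝ) - 1 := by linarith
  have hΩiff : Ω = matchedOmega I ψ μ₁ μ₂ ↔
      μ₁ ^ 2 * ((I : ℝ) + 1) - I * μ₂ = (I * Ω) ^ 2 * ((ψ - 1) / ψ) := by
    have hnn : 0 ≤ matchedOmega I ψ μ₁ μ₂ := by
      unfold matchedOmega
      positivity
    set d := μ₁ ^ 2 * ((I : ℝ) + 1) - I * μ₂ with hd
    constructor
    · intro h
      -- `Real.sqrt` is `0` on nonpositive reals, so `d ≤ 0` would force `Ω = 0`; the formula for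
      -- `Ω` thus already encodes the sign condition on `d`.
      have hdpos : 0 < d := by
        by_contra hneg
        rw [matchedOmega, ← hd, Real.sqrt_eq_zero_of_nonpos (not_lt.mp hneg)] at h
        simp at h
        exact hΩ.ne' h
      rw [h, matchedOmega, ← hd, mul_pow, mul_pow, div_pow, div_pow, Real.sq_sqrt hdpos.le,
        Real.sq_sqrt hψ0.le, Real.sq_sqrt hψ1.le]
      field_simp
    · intro h
      have hdpos : 0 ≤ d := by
        rw [h]
        positivity
      rw [← sq_eq_sq₀ hΩ.le hnn, matchedOmega, ← hd, mul_pow, div_pow, div_pow,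
        Real.sq_sqrt hdpos, Real.sq_sqrt hψ0.le, Real.sq_sqrt hψ1.le, h]
      field_simp
  have hσiff : ∀ ω : ℝ, σ2 = (μ₁ - I * ω) / I ↔ I * (σ2 + ω) = μ₁ := by
    intro ω
    rw [eq_div_iff hI0.ne']
    constructor <;> intro h <;> linarith
  have key : ∀ ν : ℝ, I * (σ2 + Ω) = ν →
      ((I * (σ2 + Ω)) ^ 2 + I * (σ2 ^ 2 + 2 * σ2 * Ω + Ω ^ 2 / ψ) = μ₂ ↔
        ν ^ 2 * ((I : ℝ) + 1) - I * μ₂ = (I * Ω) ^ 2 * ((ψ - 1) / ψ)) := by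
    rintro _ rfl
    have e : I * ((I * (σ2 + Ω)) ^ 2 + I * (σ2 ^ 2 + 2 * σ2 * Ω + Ω ^ 2 / ψ)) =
        (I * (σ2 + Ω)) ^ 2 * ((I : ℝ) + 1) - (I * Ω) ^ 2 * ((ψ - 1) / ψ) := by
      field_simp
      ring
    rw [← mul_right_inj' hI0.ne', e]
    constructor <;> intro h <;> linarith
  constructor
  · rintro ⟨h1, h2⟩
    have hm := hΩiff.mpr ((key μ₁ h1).mp h2)
    refine ⟨hm, ?_⟩
    rw [matchedSigmaSq, ← hm]
    exact (hσiff Ω).mpr h1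
  · rintro ⟨hm, h2⟩
    rw [matchedSigmaSq, ← hm] at h2
    have h1 := (hσiff Ω).mp h2
    exact ⟨h1, (key μ₁ h1).mpr (hΩiff.mp hm)⟩

end SISR

theorem lemma1 {S : Type*} [MeasurableSpace S] (P : Measure S) [IsProbabilityMeasure P]
    (I ψ : ℕ) (hI : 1 ≤ I) (hψ : 1 ≤ ψ)
    (Ω σ2 : ℝ) (hΩ : 0 < Ω) (hσ : 0 < σ2) (hσ1 : σ2 ≠ 1)
    (p q : Fin I → ℝ) (hpq : ∀ i, p i ^ 2 + q i ^ 2 = 1)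
    (X : Fin I → S → ℝ) (hX : iIndepFun X P)
    (hlaw : ∀ i, HasLaw (X i) (SISR.shadowedRicianMeasure ψ Ω σ2 (p i) (q i)) P)
    (Y : S → ℝ) (hY : ∀ s, Y s = ∑ i, X i s) :
    -- the density of `Y`
    HasLaw Y (volume.withDensity fun x => ENNReal.ofReal (SISR.sisrPDFReal I ψ Ω σ2 x)) P ∧
    -- the distribution function of `Y`, through lower incomplete Gamma functions
    (∀ x : ℝ, 0 < x → P.real {s | Y s ≤ x} =
      ∑ k ∈ Finset.range (I * ψ - I + 1),
        SISR.chi I ψ Ω σ2 k *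
          (SISR.lowerGamma ((I * ψ - k : ℕ) : ℝ) (x / SISR.alpha ψ Ω σ2) /
            (I * ψ - k - 1).factorial)) ∧
    -- the distribution function of `Y`, as a finite exponential-polynomial sum
    (∀ x : ℝ, 0 < x → P.real {s | Y s ≤ x} =
      1 - ∑ k ∈ Finset.range (I * ψ - I + 1), ∑ n ∈ Finset.range (I * ψ - k),
        SISR.chi I ψ Ω σ2 k / n.factorial * (x ^ n / SISR.alpha ψ Ω σ2 ^ n) *
          Real.exp (-x / SISR.alpha ψ Ω σ2)) ∧
    -- moment matching: the first two moments determine `Ω` and `σ²`, by the stated formulas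
    (Integrable Y P ∧ Integrable (fun s => Y s ^ 2) P ∧
      (2 ≤ ψ → ∀ μ₁ μ₂ : ℝ,
        ((∫ s, Y s ∂P = μ₁ ∧ ∫ s, Y s ^ 2 ∂P = μ₂) ↔
          (Ω = SISR.matchedOmega I ψ μ₁ μ₂ ∧ σ2 = SISR.matchedSigmaSq I ψ μ₁ μ₂)))) := by
  obtain rfl : Y = fun s => ∑ i, X i s := funext hY
  have hL := SISR.hasLaw_sum_shadowedRician hI hψ hΩ hσ hσ1 hpq hX hlaw
  have hcdf : ∀ x : ℝ, 0 < x → P.real {s | ∑ i, X i s ≤ x} =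
      ∑ k ∈ Finset.range (I * ψ - I + 1), SISR.chi I ψ Ω σ2 k *
        (SISR.lowerGamma ((I * ψ - k - 1 + 1 : ℕ) : ℝ) (x / SISR.alpha ψ Ω σ2) /
          (I * ψ - k - 1).factorial) := fun x hx => by
    rw [hL.measureReal_eq (p := (· ≤ x)) measurableSet_Iic]
    exact SISR.withDensity_sisrPDFReal_real_Iic hI hψ hΩ hσ hσ1 hx
  have hpow : ∀ j : ℕ, Integrable (fun s => (∑ i, X i s) ^ j) P := fun j => by
    have h := SISR.integrable_pow_withDensity_sisrPDFReal hI hψ hΩ hσ hσ1 j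
    rw [← hL.map_eq] at h
    exact h.comp_aemeasurable hL.aemeasurable
  refine ⟨hL, fun x hx => ?_, fun x hx => ?_, ?_, hpow 2, fun hψ2 μ₁ μ₂ => ?_⟩
  · rw [hcdf x hx]
    refine Finset.sum_congr rfl fun k hk => ?_
    rw [SISR.pred_shape_add_one hI hψ hk]
  -- Writing the leading `1` as `∑ χ_k` allows a termwise comparison.
  · rw [hcdf x hx, ← SISR.sum_chi I ψ (SISR.xi_pos hψ hΩ hσ hσ1), ← Finset.sum_sub_distrib]
    refine Finset.sum_congr rfl fun k hk => ?_
    rw [SISR.lowerGamma_natCast_succ, SISR.pred_shape_add_one hI hψ hk, mul_sub, mul_one,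
      Finset.mul_sum]
    congr 1
    refine Finset.sum_congr rfl fun n _ => ?_
    rw [div_pow, neg_div]
    ring
  · simpa using hpow 1
  · have h1 : ∫ s, ∑ i, X i s ∂P = I * (σ2 + Ω) :=
      hL.integral_eq.trans (SISR.integral_id_withDensity_sisrPDFReal hI hψ hΩ hσ hσ1)
    have h2 : ∫ s, (∑ i, X i s) ^ 2 ∂P =
        (I * (σ2 + Ω)) ^ 2 + I * (σ2 ^ 2 + 2 * σ2 * Ω + Ω ^ 2 / ψ) :=
      (hL.integral_comp (f := fun x : ℝ => x ^ 2) (by fun_prop)).trans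
        (SISR.integral_sq_withDensity_sisrPDFReal hI hψ hΩ hσ hσ1)
    rw [h1, h2]
    exact SISR.moments_eq_iff_matched hI hψ2 hΩ μ₁ μ₂
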